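/- **Setting.** Let $(\bar M,\bar g)$ be a semi-Riemannian manifold (finite-dimensional, smooth, Hausdorff, second countable, $\bar g$ of constant index) with Levi-Civita connection $\bar\nabla$. Let $p,q$ be positive integers and let $\bar J$ be a smooth $(1,1)$-tensor field on $\bar M$ with $\bar J^2=p\bar J+qI$, $\bar g(U,\bar JV)=\bar g(\bar JU,V)$ and $\bar\nabla\bar J=0$. Let $\eta$ be a smooth vector field on $\bar M$, $\pi(U)=\bar g(U,\eta)$, and let $\bar D$ be the quarter symmetric non-metric connection $$\bar D_UV=\bar\nabla_UV+\pi(V)\bar JU .$$ Let $M$ be an $r$-lightlike submanifold of $\bar M$: an immersed submanifold for which $\mathrm{Rad}(TM)=TM\cap TM^\perp$ is a smooth distribution of constant rank $r>0$, with chosen smooth subbundles $S(TM)$, $S(TM^\perp)$ and $\mathrm{ltr}(TM)$ of $T\bar M|_M$ such that $TM=\mathrm{Rad}(TM)\oplus S(TM)$, $TM^\perp=\mathrm{Rad}(TM)\oplus S(TM^\perp)$, and $\mathrm{ltr}(TM)$ is a null complement of $\mathrm{Rad}(TM)$ in $(S(TM)\oplus S(TM^\perp))^\perp$. Then $T\bar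 M|_M=TM\oplus \mathrm{ltr}(TM)\oplus S(TM^\perp)$. For $U\in\Gamma(TM)$ and a section $V$ of $T\bar M|_M$, let $D_UV$ and $\bar h^s(U,V)$ be the components of $\bar D_UV$ in $TM$ and in $S(TM^\perp)$, and let $D^*_UV$ be the component of $D_UV$ in $S(TM)$ with respect to $TM=\mathrm{Rad}(TM)\oplus S(TM)$. Suppose that $M$ is screen semi-invariant: there is a smooth distribution $B\subseteq S(TM)$ such that, with $B^\perp$ the orthogonal complement of $B$ in $S(TM)$, one has $S(TM)=B\oplus B^\perp$, $\bar J(B)=B$, $\bar J(B^\perp)\subseteq S(TM^\perp)$ and $\bar J(\mathrm{Rad}(TM))=\mathrm{Rad}(TM)$. **Theorem.** The distribution $B$ defines a totally geodesic foliation in $S(TM)$, in the sense that $D^*_UV\in\Gamma(B)$ for all $U\in\Gamma(TM)$ and $V\in\Gamma(B)$, if and only if $$\bar J\bar h^s(U,V)=p\,\pi(V)\bar JU+q\,\pi(V)U-\pi(\bar JV)\bar JU\qquad\text{for all }U\in\Gamma(TM),\ V\in\Gamma(B),$$ where the equation is understood tested against $B^\perp$: at every $x\in M$ both sides have the same $\bar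 g$-product with every vector $Z\in B^\perp_x$. The same equivalence holds when on both sides $U$ is restricted to $\Gamma(B)$. -/

import Mathlib

open scoped Manifold ContDiff Bundle

noncomputable section

namespace LightlikeGeometry

section Ambient

variable {F : Type*} [NormedAddCommGroup F] [NormedSpace ℝ F] [FiniteDimensional ℝ F]
  {N : Type*} [TopologicalSpace N] [ChartedSpace F N] [IsManifold 𝓘(ℝ, F) ∞ N]

instance (y : N) : FiniteDimensional ℝ (TangentSpace 𝓘(ℝ, F) y) :=
  inferInstanceAs (FiniteDimensional ℝ F)

/-- A semi-Riemannian metric on `N`: a smooth field of nondegenerate symmetric bilinear forms on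
the tangent spaces, of constant index. -/
structure SemiRiemannianMetric (F : Type*) [NormedAddCommGroup F] [NormedSpace ℝ F]
    [FiniteDimensional ℝ F] (N : Type*) [TopologicalSpace N] [ChartedSpace F N]
    [IsManifold 𝓘(ℝ, F) ∞ N] where
  /-- The bilinear form on each tangent space. -/
  form : ∀ y : N, TangentSpace 𝓘(ℝ, F) y →L[ℝ] TangentSpace 𝓘(ℝ, F) y →L[ℝ] ℝ
  symm : ∀ y v w, form y v w = form y w v
  nondegenerate : ∀ y v, (∀ w, form y v w = 0) → v = 0
  contMDiff : ContMDiff 𝓘(ℝ, F) (𝓘(ℝ, F).prod 𝓘(ℝ, F →L[ℝ] F →L[ℝ] ℝ)) ∞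
    (fun y ↦ Bundle.TotalSpace.mk' (F →L[ℝ] F →L[ℝ] ℝ)
      (E := fun y : N ↦ TangentSpace 𝓘(ℝ, F) y →L[ℝ] TangentSpace 𝓘(ℝ, F) y →L[ℝ] ℝ) y (form y))
  /-- The index (number of negative squares). -/
  index : ℕ
  index_eq : ∀ y, sigNeg (form y).toBilinForm.toQuadraticMap = index

/-- A linear connection on `N`. In Mathlib's convention `D V y u` is `D_u V` at `y`. -/
abbrev LinearConnection (F : Type*) [NormedAddCommGroup F] [NormedSpace ℝ F]
    (N : Type*) [TopologicalSpace N] [ChartedSpace F N] [IsManifold 𝓘(ℝ, F) ∞ N] :=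
  CovariantDerivative 𝓘(ℝ, F) F (fun y : N ↦ TangentSpace 𝓘(ℝ, F) y)

/-- `V` is differentiable at `y` as a vector field on `N`. -/
def DiffFieldAt (V : ∀ y : N, TangentSpace 𝓘(ℝ, F) y) (y : N) : Prop :=
  MDifferentiableAt 𝓘(ℝ, F) 𝓘(ℝ, F).tangent
    (fun z ↦ (Bundle.TotalSpace.mk z (V z) : TangentBundle 𝓘(ℝ, F) N)) y

/-- `V` is a smooth vector field on `N`. -/
def SmoothField (V : ∀ y : N, TangentSpace 𝓘(ℝ, F) y) : Prop :=
  ContMDiff 𝓘(ℝ, F) 𝓘(ℝ, F).tangent ∞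
    (fun z ↦ (Bundle.TotalSpace.mk z (V z) : TangentBundle 𝓘(ℝ, F) N))

/-- `∇` is the Levi-Civita connection of `g`: torsion-free, and
`u (g(V, W)) = g(∇_u V, W) + g(V, ∇_u W)`. -/
structure IsLeviCivita (g : SemiRiemannianMetric F N) (nabla : LinearConnection F N) : Prop where
  torsion_eq_zero : nabla.torsion = 0
  metric : ∀ (V W : ∀ y : N, TangentSpace 𝓘(ℝ, F) y) (y : N) (u : TangentSpace 𝓘(ℝ, F) y),
    DiffFieldAt V y → DiffFieldAt W y →
      mvfderiv 𝓘(ℝ, F) (fun z ↦ g.form z (V z) (W z)) y u =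
        g.form y (nabla V y u) (W y) + g.form y (V y) (nabla W y u)

/-- `(g, J)` is a metallic structure on `N` with positive integer parameters `p`, `q`: `J` is a
smooth `(1,1)`-tensor field with `J² = p J + q I`, and `g` is `J`-compatible. -/
structure IsMetallic (g : SemiRiemannianMetric F N)
    (J : ∀ y : N, TangentSpace 𝓘(ℝ, F) y →L[ℝ] TangentSpace 𝓘(ℝ, F) y) (p q : ℕ) : Prop where
  p_pos : 0 < p
  q_pos : 0 < q
  contMDiff : ContMDiff 𝓘(ℝ, F) (𝓘(ℝ, F).prod 𝓘(ℝ, F →L[ℝ] F)) ∞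
    (fun y ↦ Bundle.TotalSpace.mk' (F →L[ℝ] F)
      (E := fun y : N ↦ TangentSpace 𝓘(ℝ, F) y →L[ℝ] TangentSpace 𝓘(ℝ, F) y) y (J y))
  sq : ∀ y v, J y (J y v) = (p : ℝ) • J y v + (q : ℝ) • v
  compatible : ∀ y v w, g.form y v (J y w) = g.form y (J y v) w

/-- `J` is parallel for `∇`: `∇_u (J V) = J (∇_u V)` for all vector fields `V`. -/
def IsParallel (nabla : LinearConnection F N)
    (J : ∀ y : N, TangentSpace 𝓘(ℝ, F) y →L[ℝ] TangentSpace 𝓘(ℝ, F) y) : Prop :=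
  ∀ (V : ∀ y : N, TangentSpace 𝓘(ℝ, F) y) (y : N) (u : TangentSpace 𝓘(ℝ, F) y), DiffFieldAt V y →
    nabla (fun z ↦ J z (V z)) y u = J y (nabla V y u)

/-- The quarter symmetric non-metric connection `D_U V = ∇_U V + π(V) J U`, where `π = g(·, η)`. -/
def quarterSymmetricConnection (g : SemiRiemannianMetric F N) (nabla : LinearConnection F N)
    (J : ∀ y : N, TangentSpace 𝓘(ℝ, F) y →L[ℝ] TangentSpace 𝓘(ℝ, F) y)
    (eta : ∀ y : N, TangentSpace 𝓘(ℝ, F) y) : LinearConnection F N :=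
  nabla.addOneForm (fun y ↦ (g.form y (eta y)).smulRight (J y))

end Ambient

section LinearAlgebra

variable {V : Type*} [AddCommGroup V] [Module ℝ V]

/-- The orthogonal space of `P` with respect to the bilinear form `b`. -/
abbrev perp (b : LinearMap.BilinForm ℝ V) (P : Submodule ℝ V) : Submodule ℝ V := b.orthogonal P

theorem disjoint_exchange {a b c d : Submodule ℝ V} (h₁ : Disjoint a b) (h₂ : Disjoint c d)
    (h₃ : Disjoint (a ⊔ b) (c ⊔ d)) : Disjoint (a ⊔ c) (b ⊔ d) := by
  have h₄ : Disjoint a (b ⊔ (c ⊔ d)) := h₁.disjoint_sup_right_of_disjoint_sup_left h₃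
  have h₅ : Disjoint c (d ⊔ (b ⊔ a)) :=
    h₂.disjoint_sup_right_of_disjoint_sup_left (by rw [sup_comm b a]; exact h₃.symm)
  have h₆ : Disjoint c (b ⊔ d) := h₅.mono_right (by
    refine sup_le ?_ le_sup_left
    exact le_sup_left.trans le_sup_right)
  refine Disjoint.disjoint_sup_left_of_disjoint_sup_right h₆ ?_
  refine h₄.mono_right ?_
  refine sup_le (le_sup_left.trans le_sup_right) (sup_le le_sup_left ?_)
  exact le_sup_right.trans le_sup_right

/-- The pointwise linear algebra of a lightlike submanifold: in an inner product space with tangent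
space `T`, radical `T ∩ T^⊥`, screen `S`, screen transversal space `W` and lightlike transversal
space `L`, the whole space is `(S ⊕ W) ⊕ (Rad ⊕ L)`. -/
theorem decomposition [FiniteDimensional ℝ V] {b : LinearMap.BilinForm ℝ V} (hb : b.Nondegenerate)
    (hs : b.IsRefl) {T S W L : Submodule ℝ V}
    (hS₁ : Disjoint (T ⊓ perp b T) S) (hS₂ : (T ⊓ perp b T) ⊔ S = T)
    (hW₁ : Disjoint (T ⊓ perp b T) W) (hW₂ : (T ⊓ perp b T) ⊔ W = perp b T)
    (hL : (T ⊓ perp b T) ⊔ L = perp b (S ⊔ W)) :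
    Disjoint S W ∧ IsCompl (S ⊔ W) ((T ⊓ perp b T) ⊔ L) := by
  have hST : S ≤ T := hS₂ ▸ le_sup_right
  have hWT : W ≤ perp b T := hW₂ ▸ le_sup_right
  have hSW : Disjoint S W := by
    rw [Submodule.disjoint_def]
    intro x hx hx'
    exact Submodule.disjoint_def.1 hS₁ x ⟨hST hx, hWT hx'⟩ hx
  refine ⟨hSW, ?_⟩
  rw [hL, LinearMap.BilinForm.isCompl_orthogonal_iff_disjoint hs, Submodule.disjoint_def]
  intro x hx hx'
  obtain ⟨s, hs', w, hw, rfl⟩ := Submodule.mem_sup.1 hx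
  rw [LinearMap.BilinForm.mem_orthogonal_iff] at hx'
  have hsT : s ∈ perp b T := by
    rw [LinearMap.BilinForm.mem_orthogonal_iff]
    intro t ht
    rw [← hS₂] at ht
    obtain ⟨e, he, s', hs'', rfl⟩ := Submodule.mem_sup.1 ht
    have h1 : b s' (s + w) = 0 := hx' s' (Submodule.mem_sup_left hs'')
    have h2 : b s' w = 0 := hWT hw s' (hST hs'')
    have h3 : b e s = 0 := hs _ _ (he.2 s (hST hs'))
    change b (e + s') s = 0
    rw [map_add] at h1
    rw [map_add, LinearMap.add_apply, h3, zero_add]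
    linarith
  have hs0 : s = 0 := Submodule.disjoint_def.1 hS₁ s ⟨hST hs', hsT⟩ hs'
  subst hs0
  rw [zero_add] at hx' ⊢
  have hwT : w ∈ T := by
    rw [← LinearMap.BilinForm.orthogonal_orthogonal hb hs T,
      LinearMap.BilinForm.mem_orthogonal_iff]
    intro t ht
    change t ∈ perp b T at ht
    rw [← hW₂] at ht
    obtain ⟨e, he, w', hw', rfl⟩ := Submodule.mem_sup.1 ht
    have h1 : b w' w = 0 := hx' w' (Submodule.mem_sup_right hw')
    have h3 : b e w = 0 := hWT hw e he.1
    change b (e + w') w = 0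
    rw [map_add, LinearMap.add_apply, h1, h3, zero_add]
  exact Submodule.disjoint_def.1 hW₁ w ⟨hwT, hWT hw⟩ hw

end LinearAlgebra

section Submanifold

variable {E : Type*} [NormedAddCommGroup E] [NormedSpace ℝ E] [FiniteDimensional ℝ E]
  {M : Type*} [TopologicalSpace M] [ChartedSpace E M] [IsManifold 𝓘(ℝ, E) ∞ M]
  {F : Type*} [NormedAddCommGroup F] [NormedSpace ℝ F] [FiniteDimensional ℝ F]
  {N : Type*} [TopologicalSpace N] [ChartedSpace F N] [IsManifold 𝓘(ℝ, F) ∞ N]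

/-- The field `V` along the map `i : M → N` (a section of the pull-back of `TN`) is smooth on the
set `s`. -/
def SmoothAlongOn (i : M → N) (V : ∀ x : M, TangentSpace 𝓘(ℝ, F) (i x)) (s : Set M) : Prop :=
  ContMDiffOn 𝓘(ℝ, E) 𝓘(ℝ, F).tangent ∞
    (fun x ↦ (Bundle.TotalSpace.mk (i x) (V x) : TangentBundle 𝓘(ℝ, F) N)) s

/-- `P` is a smooth vector subbundle of rank `k` of the pull-back of `TN` along `i : M → N`: near
every point it has a smooth frame of `k` sections. -/
def IsSubbundle (i : M → N) (P : ∀ x : M, Submodule ℝ (TangentSpace 𝓘(ℝ, F) (i x))) (k : ℕ) :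
    Prop :=
  ∀ x₀ : M, ∃ s : Set M, IsOpen s ∧ x₀ ∈ s ∧
    ∃ e : Fin k → ∀ x : M, TangentSpace 𝓘(ℝ, F) (i x),
      (∀ j, SmoothAlongOn (E := E) i (e j) s) ∧
      ∀ x ∈ s, LinearIndependent ℝ (fun j ↦ e j x) ∧
        Submodule.span ℝ (Set.range fun j ↦ e j x) = P x

/-- `V ∈ Γ(P)`: `V` is a smooth section of the subbundle `P` along `i`. -/
def IsSection (i : M → N) (P : ∀ x : M, Submodule ℝ (TangentSpace 𝓘(ℝ, F) (i x)))
    (V : ∀ x : M, TangentSpace 𝓘(ℝ, F) (i x)) : Prop :=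
  SmoothAlongOn (E := E) i V Set.univ ∧ ∀ x, V x ∈ P x

/-- The pull-back of the linear connection `D` along `i : M → N`: the derivative `D_u V` at `x` of a
field `V` along `i` in the direction `u ∈ T_x M`. In the trivialization of `TN` around `i x`, with
`c` the coordinate expression of `V`, this is `dc(u)` plus `D_{di(u)}` of the local field with
constant coordinates `c x`. -/
def pullbackConnection (D : LinearConnection F N) (i : M → N)
    (V : ∀ x : M, TangentSpace 𝓘(ℝ, F) (i x)) (x : M) (u : TangentSpace 𝓘(ℝ, E) x) :
    TangentSpace 𝓘(ℝ, F) (i x) :=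
  (trivializationAt F (TangentSpace 𝓘(ℝ, F)) (i x)).symm (i x)
      (mvfderiv 𝓘(ℝ, E)
        (fun z ↦ (trivializationAt F (TangentSpace 𝓘(ℝ, F)) (i x)
          (Bundle.TotalSpace.mk (i z) (V z) : TangentBundle 𝓘(ℝ, F) N)).2) x u)
    + D (FiberBundle.extend F (V x)) (i x) (mfderiv 𝓘(ℝ, E) 𝓘(ℝ, F) i x u)

/-- The tangent space of `M` at `x`, as a subspace of the ambient tangent space. -/
def tangentRange (i : M → N) (x : M) : Submodule ℝ (TangentSpace 𝓘(ℝ, F) (i x)) :=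
  LinearMap.range (mfderiv 𝓘(ℝ, E) 𝓘(ℝ, F) i x).toLinearMap

/-- The radical space `T_x M ∩ (T_x M)^⊥`. -/
def radical (g : SemiRiemannianMetric F N) (i : M → N) (x : M) :
    Submodule ℝ (TangentSpace 𝓘(ℝ, F) (i x)) :=
  tangentRange (E := E) i x ⊓ perp (g.form (i x)).toBilinForm (tangentRange (E := E) i x)

/-- An `r`-lightlike submanifold `(M, g, S(TM), S(TM^⊥))` of `(N, g)`, `r > 0`, given by an
immersion of `M`, together with a screen distribution `S(TM)`, a screen transversal bundle
`S(TM^⊥)`, and a lightlike transversal bundle `ltr(TM)`. -/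
structure LightlikeSubmanifold (E : Type*) [NormedAddCommGroup E] [NormedSpace ℝ E]
    [FiniteDimensional ℝ E] (M : Type*) [TopologicalSpace M] [ChartedSpace E M]
    [IsManifold 𝓘(ℝ, E) ∞ M] (g : SemiRiemannianMetric F N) where
  /-- The immersion. -/
  imm : M → N
  contMDiff_imm : ContMDiff 𝓘(ℝ, E) 𝓘(ℝ, F) ∞ imm
  injective_mfderiv : ∀ x, Function.Injective (mfderiv 𝓘(ℝ, E) 𝓘(ℝ, F) imm x)
  /-- The rank of the radical distribution. -/
  r : ℕ
  r_pos : 0 < r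
  radical_subbundle : IsSubbundle (E := E) imm (fun x ↦ radical (E := E) g imm x) r
  /-- The screen distribution `S(TM)`. -/
  screen : ∀ x : M, Submodule ℝ (TangentSpace 𝓘(ℝ, F) (imm x))
  screen_subbundle : ∃ k, IsSubbundle (E := E) imm screen k
  screen_disjoint : ∀ x, Disjoint (radical (E := E) g imm x) (screen x)
  screen_sup : ∀ x, radical (E := E) g imm x ⊔ screen x = tangentRange (E := E) imm x
  /-- The screen transversal bundle `S(TM^⊥)`. -/
  screenTransversal : ∀ x : M, Submodule ℝ (TangentSpace 𝓘(ℝ, F) (imm x))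
  screenTransversal_subbundle : ∃ k, IsSubbundle (E := E) imm screenTransversal k
  screenTransversal_disjoint : ∀ x, Disjoint (radical (E := E) g imm x) (screenTransversal x)
  screenTransversal_sup : ∀ x, radical (E := E) g imm x ⊔ screenTransversal x =
    perp (g.form (imm x)).toBilinForm (tangentRange (E := E) imm x)
  /-- The lightlike transversal bundle `ltr(TM)`: a null complement of `Rad(TM)` in the orthogonal
  complement of `S(TM) ⊥ S(TM^⊥)`. -/
  ltr : ∀ x : M, Submodule ℝ (TangentSpace 𝓘(ℝ, F) (imm x))
  ltr_subbundle : ∃ k, IsSubbundle (E := E) imm ltr k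
  ltr_disjoint : ∀ x, Disjoint (radical (E := E) g imm x) (ltr x)
  ltr_sup : ∀ x, radical (E := E) g imm x ⊔ ltr x =
    perp (g.form (imm x)).toBilinForm (screen x ⊔ screenTransversal x)
  ltr_null : ∀ x, ∀ n ∈ ltr x, ∀ n' ∈ ltr x, g.form (imm x) n n' = 0

namespace LightlikeSubmanifold

variable {g : SemiRiemannianMetric F N} (L : LightlikeSubmanifold E M g)

/-- `T_x M` inside the ambient tangent space. -/
abbrev tangent (x : M) : Submodule ℝ (TangentSpace 𝓘(ℝ, F) (L.imm x)) :=
  tangentRange (E := E) L.imm x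

/-- `Rad(TM)` at `x`. -/
abbrev rad (x : M) : Submodule ℝ (TangentSpace 𝓘(ℝ, F) (L.imm x)) :=
  radical (E := E) g L.imm x

theorem ambient_decomposition (x : M) : Disjoint (L.screen x) (L.screenTransversal x) ∧
    IsCompl (L.screen x ⊔ L.screenTransversal x) (L.rad x ⊔ L.ltr x) := by
  have hs : (g.form (L.imm x)).toBilinForm.IsRefl := fun v w h ↦ by
    simpa [g.symm (L.imm x) w v] using h
  refine decomposition ?_ hs (L.screen_disjoint x) (L.screen_sup x)
    (L.screenTransversal_disjoint x) (L.screenTransversal_sup x) (L.ltr_sup x)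
  exact ⟨fun v hv ↦ g.nondegenerate _ v hv,
    fun v hv ↦ g.nondegenerate _ v fun w ↦ by rw [g.symm]; exact hv w⟩

/-- `TN|_M = TM ⊕ tr(TM)` with `tr(TM) = ltr(TM) ⊥ S(TM^⊥)`. -/
theorem isCompl_tangent (x : M) :
    IsCompl (L.tangent x) (L.ltr x ⊔ L.screenTransversal x) := by
  obtain ⟨h, h'⟩ := L.ambient_decomposition x
  have ht : L.tangent x = L.screen x ⊔ L.rad x := by rw [sup_comm]; exact (L.screen_sup x).symm
  constructor
  · rw [ht, sup_comm (L.ltr x)]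
    exact disjoint_exchange h (L.ltr_disjoint x) h'.disjoint
  · rw [codisjoint_iff, ht, ← h'.sup_eq_top]
    ac_rfl

/-- `TN|_M = S(TM^⊥) ⊕ (TM ⊕ ltr(TM))`. -/
theorem isCompl_screenTransversal (x : M) :
    IsCompl (L.screenTransversal x) (L.tangent x ⊔ L.ltr x) := by
  obtain ⟨h, h'⟩ := L.ambient_decomposition x
  have ht : L.tangent x = L.rad x ⊔ L.screen x := (L.screen_sup x).symm
  constructor
  · rw [ht, sup_comm (L.rad x), sup_assoc]
    exact h.symm.disjoint_sup_right_of_disjoint_sup_left (by rw [sup_comm]; exact h'.disjoint)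
  · rw [codisjoint_iff, ht, ← h'.sup_eq_top]
    ac_rfl

/-- `TN|_M = S(TM) ⊕ (Rad(TM) ⊕ tr(TM))`. -/
theorem isCompl_screen (x : M) :
    IsCompl (L.screen x) (L.rad x ⊔ (L.ltr x ⊔ L.screenTransversal x)) := by
  obtain ⟨h, h'⟩ := L.ambient_decomposition x
  have hr : L.rad x ⊔ (L.ltr x ⊔ L.screenTransversal x) =
      L.screenTransversal x ⊔ (L.rad x ⊔ L.ltr x) := by ac_rfl
  rw [hr]
  constructor
  · exact h.disjoint_sup_right_of_disjoint_sup_left h'.disjoint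
  · rw [codisjoint_iff, ← h'.sup_eq_top]
    ac_rfl

/-- The projection onto `TM` along `tr(TM)`. -/
def tangentProj (x : M) : TangentSpace 𝓘(ℝ, F) (L.imm x) →ₗ[ℝ] TangentSpace 𝓘(ℝ, F) (L.imm x) :=
  Submodule.projection _ _ (L.isCompl_tangent x)

/-- The projection onto `S(TM^⊥)` along `TM ⊕ ltr(TM)`. -/
def screenTransversalProj (x : M) :
    TangentSpace 𝓘(ℝ, F) (L.imm x) →ₗ[ℝ] TangentSpace 𝓘(ℝ, F) (L.imm x) :=
  Submodule.projection _ _ (L.isCompl_screenTransversal x)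

/-- The projection onto `S(TM)`; on `TM` it is the projection along `Rad(TM)`. -/
def screenProj (x : M) : TangentSpace 𝓘(ℝ, F) (L.imm x) →ₗ[ℝ] TangentSpace 𝓘(ℝ, F) (L.imm x) :=
  Submodule.projection _ _ (L.isCompl_screen x)

variable (D : LinearConnection F N) (V : ∀ x : M, TangentSpace 𝓘(ℝ, F) (L.imm x))
  (x : M) (u : TangentSpace 𝓘(ℝ, E) x)

/-- The connection induced on `TM` by an ambient connection `D`: the `TM`-component of `D_u V`. -/
def inducedConnection : TangentSpace 𝓘(ℝ, F) (L.imm x) :=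
  L.tangentProj x (pullbackConnection D L.imm V x u)

/-- The screen second fundamental form of an ambient connection `D`: the `S(TM^⊥)`-component
`h^s(u, V)` of `D_u V`. -/
def hs : TangentSpace 𝓘(ℝ, F) (L.imm x) :=
  L.screenTransversalProj x (pullbackConnection D L.imm V x u)

/-- The connection `D^*` induced on the screen distribution: the `S(TM)`-component of the induced
connection of `M`. -/
def screenConnection : TangentSpace 𝓘(ℝ, F) (L.imm x) :=
  L.screenProj x (L.inducedConnection D V x u)

/-- `B^⊥`, the orthogonal complement of `B` in `S(TM)`. -/
def screenPerp (B : ∀ x : M, Submodule ℝ (TangentSpace 𝓘(ℝ, F) (L.imm x))) (x : M) :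
    Submodule ℝ (TangentSpace 𝓘(ℝ, F) (L.imm x)) :=
  L.screen x ⊓ perp (g.form (L.imm x)).toBilinForm (B x)

/-- `M` is a screen semi-invariant lightlike submanifold with distribution `B ⊆ S(TM)`. -/
structure IsScreenSemiInvariant
    (J : ∀ y : N, TangentSpace 𝓘(ℝ, F) y →L[ℝ] TangentSpace 𝓘(ℝ, F) y)
    (B : ∀ x : M, Submodule ℝ (TangentSpace 𝓘(ℝ, F) (L.imm x))) : Prop where
  subbundle : ∃ k, IsSubbundle (E := E) L.imm B k
  le_screen : ∀ x, B x ≤ L.screen x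
  disjoint : ∀ x, Disjoint (B x) (L.screenPerp B x)
  sup : ∀ x, B x ⊔ L.screenPerp B x = L.screen x
  map_B : ∀ x, (B x).map (J (L.imm x)).toLinearMap = B x
  map_perp : ∀ x, (L.screenPerp B x).map (J (L.imm x)).toLinearMap ≤ L.screenTransversal x
  map_rad : ∀ x, (L.rad x).map (J (L.imm x)).toLinearMap = L.rad x

/-- The image in the ambient tangent space of the vector field `U` on `M`. -/
def push (U : ∀ x : M, TangentSpace 𝓘(ℝ, E) x) (x : M) : TangentSpace 𝓘(ℝ, F) (L.imm x) :=
  mfderiv 𝓘(ℝ, E) 𝓘(ℝ, F) L.imm x (U x)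

/-- `B` defines a totally geodesic foliation in `S(TM)`, in the directions of the distribution `P`:
`D^*_U V ∈ Γ(B)` for all `U ∈ Γ(P)` and `V ∈ Γ(B)`. -/
def TotallyGeodesicInScreen (B P : ∀ x : M, Submodule ℝ (TangentSpace 𝓘(ℝ, F) (L.imm x))) : Prop :=
  ∀ (U : ∀ x : M, TangentSpace 𝓘(ℝ, E) x) (V : ∀ x : M, TangentSpace 𝓘(ℝ, F) (L.imm x)),
    SmoothField U → (∀ x, L.push U x ∈ P x) → IsSection (E := E) L.imm B V →
      ∀ x, L.screenConnection D V x (U x) ∈ B x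

/-- The identity `J h^s(U, V) = p π(V) J U + q π(V) U - π(J V) J U`, tested against `B^⊥`, for all
`U ∈ Γ(P)` and `V ∈ Γ(B)`; here `h^s` is formed with the connection `D` and `π = g(·, η)`. -/
def ScreenIdentity (J : ∀ y : N, TangentSpace 𝓘(ℝ, F) y →L[ℝ] TangentSpace 𝓘(ℝ, F) y)
    (p q : ℕ) (eta : ∀ y : N, TangentSpace 𝓘(ℝ, F) y)
    (B P : ∀ x : M, Submodule ℝ (TangentSpace 𝓘(ℝ, F) (L.imm x))) : Prop :=
  ∀ (U : ∀ x : M, TangentSpace 𝓘(ℝ, E) x) (V : ∀ x : M, TangentSpace 𝓘(ℝ, F) (L.imm x)),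
    SmoothField U → (∀ x, L.push U x ∈ P x) → IsSection (E := E) L.imm B V →
      ∀ x, ∀ z ∈ L.screenPerp B x,
        g.form (L.imm x) (J (L.imm x) (L.hs D V x (U x))) z =
          g.form (L.imm x)
            (((p : ℝ) * g.form (L.imm x) (V x) (eta (L.imm x))) • J (L.imm x) (L.push U x)
              + ((q : ℝ) * g.form (L.imm x) (V x) (eta (L.imm x))) • L.push U x
              - g.form (L.imm x) (J (L.imm x) (V x)) (eta (L.imm x)) • J (L.imm x) (L.push U x)) z

end LightlikeSubmanifold

end Submanifold

end LightlikeGeometry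

end

open LightlikeGeometry

/-!
The theorem rests on one identity. Let `D_U V = ∇_U V + π(V) J U`, `U ∈ Γ(TM)`, `V ∈ Γ(B)` and
`Z ∈ B^⊥`. Since `J Z ∈ S(TM^⊥)` and every component of `D_U V` other than `h^s(U, V)` is
orthogonal to `S(TM^⊥)`, compatibility of `J` with `g` gives
`g(J h^s(U, V), Z) = g(h^s(U, V), J Z) = g(D_U V, J Z) = g(J D_U V, Z)`. Because `J` is parallel
and `J² = p J + q I`,
`J D_U V = D_U (J V) - π(J V) J U + π(V) (p J U + q U)`,
and pairing with `Z ∈ S(TM)` only sees the component `D^*_U (J V)` of `D_U (J V)`. So the tested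
equation for `V` says exactly that `D^*_U (J V)` is orthogonal to `B^⊥` (`form_J_hs`), and this means
`D^*_U (J V) ∈ B` (`mem_iff_forall_screenPerp`). As `J` maps `Γ(B)` to itself, a totally geodesic `B`
satisfies the equation. Conversely the equation for `V` and for `J V` puts `D^*_U (J V)` and
`D^*_U (J² V) = p D^*_U (J V) + q D^*_U V` in `B`, hence also `D^*_U V`, as `q ≠ 0`.

The analytic input is that `J` is parallel for the connection pulled back along the immersion
(`pullbackConnection_apply_of_isParallel`). The pull-back is defined in a trivialization, and the
hypothesis on `J` concerns fields on the ambient manifold only; it is used for the field with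
constant coordinates, where the coordinate formula `covariantDerivative_eq_coordAt` turns it into an
expression for the derivative of the matrix of `J`. The product rule then gives the claim for fields
along the immersion.
-/

open LightlikeGeometry

namespace LightlikeGeometry

open ContinuousLinearMap (inCoordinates)

/-! ### Derivatives of vector-valued functions on a manifold -/

section Calculus

variable {E : Type*} [NormedAddCommGroup E] [NormedSpace ℝ E]
  {M : Type*} [TopologicalSpace M] [ChartedSpace E M]
  {F G : Type*} [NormedAddCommGroup F] [NormedSpace ℝ F] [NormedAddCommGroup G] [NormedSpace ℝ G]

theorem mvfderiv_congr {f f' : M → F} {x : M} (h : ∀ᶠ z in nhds x, f z = f' z) :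
    mvfderiv 𝓘(ℝ, E) f x = mvfderiv 𝓘(ℝ, E) f' x := by
  have h' := Filter.EventuallyEq.mfderiv_eq (I := 𝓘(ℝ, E)) (I' := 𝓘(ℝ, F)) h
  ext u
  exact congrArg (fun A : E →L[ℝ] F ↦ A u) h'

/-- The product rule for a field of continuous linear maps applied to a vector-valued function. -/
theorem mvfderiv_clm_apply {A : M → F →L[ℝ] G} {c : M → F} {x : M}
    (hA : MDifferentiableAt 𝓘(ℝ, E) 𝓘(ℝ, F →L[ℝ] G) A x)
    (hc : MDifferentiableAt 𝓘(ℝ, E) 𝓘(ℝ, F) c x) (u : TangentSpace 𝓘(ℝ, E) x) :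
    mvfderiv 𝓘(ℝ, E) (fun z ↦ A z (c z)) x u =
      A x (mvfderiv 𝓘(ℝ, E) c x u) + mvfderiv 𝓘(ℝ, E) A x u (c x) := by
  have hb : HasFDerivAt (fun w : (F →L[ℝ] G) × F ↦ w.1 w.2) _ (A x, c x) :=
    (hasFDerivAt_fst (𝕜 := ℝ) (p := (A x, c x))).clm_apply hasFDerivAt_snd
  have hp : HasMFDerivAt 𝓘(ℝ, E) 𝓘(ℝ, (F →L[ℝ] G) × F) (fun z ↦ (A z, c z)) x
      ((mfderiv 𝓘(ℝ, E) 𝓘(ℝ, F →L[ℝ] G) A x).prod (mfderiv 𝓘(ℝ, E) 𝓘(ℝ, F) c x)) :=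
    ⟨hA.hasMFDerivAt.1.prodMk hc.hasMFDerivAt.1, hA.hasMFDerivAt.2.prodMk hc.hasMFDerivAt.2⟩
  have h := (HasMFDerivAt.comp x hb.hasMFDerivAt hp).mfderiv
  exact congrArg (fun A : E →L[ℝ] G ↦ A u) h

end Calculus

/-! ### Connections in coordinates -/

section Ambient

variable {F : Type*} [NormedAddCommGroup F] [NormedSpace ℝ F]
  {N : Type*} [TopologicalSpace N] [ChartedSpace F N] [IsManifold 𝓘(ℝ, F) ∞ N]

/-- The coordinates of the vector `v ∈ T_z N` in the preferred trivialization of `TN` at `y`. -/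
noncomputable abbrev coordAt (y z : N) (v : TangentSpace 𝓘(ℝ, F) z) : F :=
  (trivializationAt F (TangentSpace 𝓘(ℝ, F)) y
    (Bundle.TotalSpace.mk z v : TangentBundle 𝓘(ℝ, F) N)).2

/-- In coordinates, an endomorphism of the fibre acts by its `inCoordinates` expression. This is the
reading of a `(1,1)`-tensor field as a matrix-valued function. -/
theorem coordAt_clm_apply {y z : N}
    (hz : z ∈ (trivializationAt F (TangentSpace 𝓘(ℝ, F)) y).baseSet)
    (A : TangentSpace 𝓘(ℝ, F) z →L[ℝ] TangentSpace 𝓘(ℝ, F) z) (v : TangentSpace 𝓘(ℝ, F) z) :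
    coordAt y z (A v) = inCoordinates F (TangentSpace 𝓘(ℝ, F)) F (TangentSpace 𝓘(ℝ, F)) y z y z A
      (coordAt y z v) := by
  rw [ContinuousLinearMap.inCoordinates_eq hz hz]
  simp [coordAt, Bundle.Trivialization.symm_apply_apply_mk _ hz]

theorem diffFieldAt_iff {W : ∀ y : N, TangentSpace 𝓘(ℝ, F) y} {y : N} :
    DiffFieldAt W y ↔ MDifferentiableAt 𝓘(ℝ, F) 𝓘(ℝ, F) (fun z ↦ coordAt y z (W z)) y :=
  mdifferentiableAt_section _ _

theorem diffFieldAt_extend {y : N} (v : TangentSpace 𝓘(ℝ, F) y) :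
    DiffFieldAt (FiberBundle.extend F v) y :=
  FiberBundle.mdifferentiableAt_extend ..

/-- `FiberBundle.extend` has constant coordinates near its base point. -/
theorem coordAt_extend {y : N} (v : TangentSpace 𝓘(ℝ, F) y) :
    ∀ᶠ z in nhds y, coordAt y z (FiberBundle.extend F v z) = coordAt y y v := by
  filter_upwards [(trivializationAt F (TangentSpace 𝓘(ℝ, F)) y).open_baseSet.mem_nhds
    (FiberBundle.mem_baseSet_trivializationAt' y)] with z hz
  simp [coordAt, FiberBundle.extend, Bundle.Trivialization.apply_mk_symm _ hz]

/-- The coordinate formula for a connection: `D_u W` is the derivative of the coordinates of `W` plus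
`D_u` of the field with constant coordinates. The difference of `D_u W` and the coordinate
derivative is tensorial in `W`, so it may be computed on that constant field. -/
theorem covariantDerivative_eq_coordAt [FiniteDimensional ℝ F] (D : LinearConnection F N)
    {W : ∀ y : N, TangentSpace 𝓘(ℝ, F) y} {y : N} (hW : DiffFieldAt W y)
    (u : TangentSpace 𝓘(ℝ, F) y) :
    D W y u = (trivializationAt F (TangentSpace 𝓘(ℝ, F)) y).symm y
        (mvfderiv 𝓘(ℝ, F) (fun z ↦ coordAt y z (W z)) y u)
      + D (FiberBundle.extend F (W y)) y u := by
  set e := trivializationAt F (TangentSpace 𝓘(ℝ, F)) y with he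
  have hy : y ∈ e.baseSet := FiberBundle.mem_baseSet_trivializationAt' y
  have hb : ∀ᶠ z in nhds y, z ∈ e.baseSet := e.open_baseSet.mem_nhds hy
  rw [← e.symmL_apply (R := ℝ) hy]
  have hT : TensorialAt 𝓘(ℝ, F) F (fun W : ∀ y : N, TangentSpace 𝓘(ℝ, F) y ↦
      D W y u - e.symmL ℝ y (mvfderiv 𝓘(ℝ, F) (fun z ↦ coordAt y z (W z)) y u)) y := by
    constructor
    · intro f σ hf hσ
      have h1 : mvfderiv 𝓘(ℝ, F) (fun z ↦ coordAt y z ((f • σ) z)) y =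
          mvfderiv 𝓘(ℝ, F) (f • fun z ↦ coordAt y z (σ z)) y := by
        refine mvfderiv_congr (hb.mono fun z hz ↦ ?_)
        have := (e.linear ℝ hz).map_smul (f z) (σ z)
        simpa [coordAt] using this
      have h2 := congrArg (fun A ↦ A u) (D.isCovariantDerivativeOnUniv.leibniz hσ hf)
      rw [h1, h2, mvfderiv_smul hf (diffFieldAt_iff.1 hσ)]
      have h3 : e.symmL ℝ y (coordAt y y (σ y)) = σ y := by
        rw [e.symmL_apply hy]; exact e.symm_apply_apply_mk hy _
      simp [h3, smul_sub]
    · intro σ σ' hσ hσ'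
      have h1 : mvfderiv 𝓘(ℝ, F) (fun z ↦ coordAt y z ((σ + σ') z)) y =
          mvfderiv 𝓘(ℝ, F) ((fun z ↦ coordAt y z (σ z)) + fun z ↦ coordAt y z (σ' z)) y := by
        refine mvfderiv_congr (hb.mono fun z hz ↦ ?_)
        have := (e.linear ℝ hz).map_add (σ z) (σ' z)
        simpa [coordAt] using this
      have h2 := congrArg (fun A ↦ A u) (D.isCovariantDerivativeOnUniv.add hσ hσ')
      rw [h1, h2, mvfderiv_add (diffFieldAt_iff.1 hσ) (diffFieldAt_iff.1 hσ')]
      simp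
      abel
  have h := hT.pointwise hW (diffFieldAt_extend (W y)) (by simp)
  -- the field `extend` has constant coordinates, so its coordinate derivative vanishes
  have h0 : mvfderiv 𝓘(ℝ, F) (fun z ↦ coordAt y z (FiberBundle.extend F (W y) z)) y = 0 := by
    rw [mvfderiv_congr (coordAt_extend (W y)), mvfderiv_const]
  simp only [h0, zero_apply, map_zero, sub_zero] at h
  rw [← h]
  abel

end Ambient

/-! ### Pull-back connections -/

section Pullback

variable {E : Type*} [NormedAddCommGroup E] [NormedSpace ℝ E]
  {M : Type*} [TopologicalSpace M] [ChartedSpace E M]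
  {F : Type*} [NormedAddCommGroup F] [NormedSpace ℝ F] [FiniteDimensional ℝ F]
  {N : Type*} [TopologicalSpace N] [ChartedSpace F N] [IsManifold 𝓘(ℝ, F) ∞ N]

/-- A `(1,1)`-tensor field parallel for `∇` on `N` is parallel for the pull-back of `∇` along any map
`i`, although a field along `i` need not extend to a vector field on `N`. -/
theorem pullbackConnection_apply_of_isParallel {nabla : LinearConnection F N}
    {J : ∀ y : N, TangentSpace 𝓘(ℝ, F) y →L[ℝ] TangentSpace 𝓘(ℝ, F) y}
    (hJ : ContMDiff 𝓘(ℝ, F) (𝓘(ℝ, F).prod 𝓘(ℝ, F →L[ℝ] F)) ∞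
      (fun y ↦ Bundle.TotalSpace.mk' (F →L[ℝ] F)
        (E := fun y : N ↦ TangentSpace 𝓘(ℝ, F) y →L[ℝ] TangentSpace 𝓘(ℝ, F) y) y (J y)))
    (hJpar : IsParallel nabla J) {i : M → N} {V : ∀ x : M, TangentSpace 𝓘(ℝ, F) (i x)} {x : M}
    (hV : MDifferentiableAt 𝓘(ℝ, E) 𝓘(ℝ, F).tangent
      (fun z ↦ (Bundle.TotalSpace.mk (i z) (V z) : TangentBundle 𝓘(ℝ, F) N)) x)
    (u : TangentSpace 𝓘(ℝ, E) x) :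
    pullbackConnection nabla i (fun z ↦ J (i z) (V z)) x u =
      J (i x) (pullbackConnection nabla i V x u) := by
  obtain ⟨hi, hc⟩ := (mdifferentiableAt_totalSpace _ _).1 hV
  set y := i x with hy
  set e := trivializationAt F (TangentSpace 𝓘(ℝ, F)) y with he
  have hye : y ∈ e.baseSet := FiberBundle.mem_baseSet_trivializationAt' y
  have hb : ∀ᶠ z in nhds y, z ∈ e.baseSet := e.open_baseSet.mem_nhds hye
  set j : N → F →L[ℝ] F := fun z ↦
    inCoordinates F (TangentSpace 𝓘(ℝ, F)) F (TangentSpace 𝓘(ℝ, F)) y z y z (J z) with hj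
  have hjd : MDifferentiableAt 𝓘(ℝ, F) 𝓘(ℝ, F →L[ℝ] F) j y :=
    ((mdifferentiableAt_hom_bundle _).1 ((hJ y).mdifferentiableAt (by simp))).2
  -- `J` commutes with passing from coordinates to vectors
  have hsymm : ∀ w, e.symm y (j y w) = J y (e.symm y w) := by
    intro w
    have h := coordAt_clm_apply hye (J y) (e.symm y w)
    have h' : coordAt y y (e.symm y w) = w := congrArg Prod.snd (e.apply_mk_symm hye w)
    rw [h'] at h
    rw [hj]; simp only; rw [← h]
    exact e.symm_apply_apply_mk hye _
  -- the derivative of the coordinates of `J V` along `i`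
  have h1 : mvfderiv 𝓘(ℝ, E) (fun z ↦ coordAt y (i z) (J (i z) (V z))) x u =
      j y (mvfderiv 𝓘(ℝ, E) (fun z ↦ coordAt y (i z) (V z)) x u) +
        mvfderiv 𝓘(ℝ, F) j y (mfderiv 𝓘(ℝ, E) 𝓘(ℝ, F) i x u) (coordAt y y (V x)) := by
    rw [mvfderiv_congr ((hi.continuousAt.eventually hb).mono
      fun z hz ↦ coordAt_clm_apply hz (J (i z)) (V z))]
    rw [mvfderiv_clm_apply (A := fun z ↦ j (i z)) (hjd.comp x hi) hc]
    congr 2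
    exact congrArg (fun A : E →L[ℝ] F →L[ℝ] F ↦ A u)
      (HasMFDerivAt.comp x hjd.hasMFDerivAt hi.hasMFDerivAt).mfderiv
  -- the covariant derivative of `J` applied to the field with constant coordinates
  have hext : DiffFieldAt (fun z ↦ J z (FiberBundle.extend F (V x) z)) y :=
    ((hJ y).mdifferentiableAt (by simp)).clm_bundle_apply (diffFieldAt_extend (V x))
  set w : TangentSpace 𝓘(ℝ, F) y := mfderiv 𝓘(ℝ, E) 𝓘(ℝ, F) i x u with hw
  have h2 := covariantDerivative_eq_coordAt nabla hext w
  rw [hJpar _ _ _ (diffFieldAt_extend (V x))] at h2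
  have h3 : mvfderiv 𝓘(ℝ, F) (fun z ↦ coordAt y z (J z (FiberBundle.extend F (V x) z))) y w =
      mvfderiv 𝓘(ℝ, F) j y w (coordAt y y (V x)) := by
    rw [mvfderiv_congr (f' := fun z ↦ j z (coordAt y y (V x)))
      ((hb.and (coordAt_extend (V x))).mono fun z hz ↦ by
        rw [coordAt_clm_apply hz.1, hz.2]),
      mvfderiv_clm_apply hjd mdifferentiableAt_const, mvfderiv_const]
    simp
  rw [h3, FiberBundle.extend_apply_self] at h2
  unfold pullbackConnection
  have hadd : ∀ a b, e.symm y (a + b) = e.symm y a + e.symm y b := fun a b ↦ by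
    simp only [← e.symmL_apply (R := ℝ) hye, map_add]
  rw [map_add, h2]
  change e.symm y (mvfderiv 𝓘(ℝ, E) (fun z ↦ coordAt y (i z) (J (i z) (V z))) x u) + _ = _
  rw [h1, hadd, hsymm, add_assoc]

theorem pullbackConnection_quarterSymmetric (g : SemiRiemannianMetric F N)
    (nabla : LinearConnection F N)
    (J : ∀ y : N, TangentSpace 𝓘(ℝ, F) y →L[ℝ] TangentSpace 𝓘(ℝ, F) y)
    (eta : ∀ y : N, TangentSpace 𝓘(ℝ, F) y) (i : M → N)
    (V : ∀ x : M, TangentSpace 𝓘(ℝ, F) (i x)) (x : M) (u : TangentSpace 𝓘(ℝ, E) x) :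
    pullbackConnection (quarterSymmetricConnection g nabla J eta) i V x u =
      pullbackConnection nabla i V x u +
        g.form (i x) (V x) (eta (i x)) • J (i x) (mfderiv 𝓘(ℝ, E) 𝓘(ℝ, F) i x u) := by
  have h : quarterSymmetricConnection g nabla J eta (FiberBundle.extend F (V x)) (i x)
      (mfderiv 𝓘(ℝ, E) 𝓘(ℝ, F) i x u) =
      nabla (FiberBundle.extend F (V x)) (i x) (mfderiv 𝓘(ℝ, E) 𝓘(ℝ, F) i x u) +
        g.form (i x) (eta (i x)) (FiberBundle.extend F (V x) (i x)) •
          J (i x) (mfderiv 𝓘(ℝ, E) 𝓘(ℝ, F) i x u) := rfl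
  rw [FiberBundle.extend_apply_self, g.symm] at h
  unfold pullbackConnection
  rw [h, add_assoc]

end Pullback

/-! ### Screen semi-invariant lightlike submanifolds -/

section Submanifold

variable {E : Type*} [NormedAddCommGroup E] [NormedSpace ℝ E] [FiniteDimensional ℝ E]
  {M : Type*} [TopologicalSpace M] [ChartedSpace E M] [IsManifold 𝓘(ℝ, E) ∞ M]
  {F : Type*} [NormedAddCommGroup F] [NormedSpace ℝ F] [FiniteDimensional ℝ F]
  {N : Type*} [TopologicalSpace N] [ChartedSpace F N] [IsManifold 𝓘(ℝ, F) ∞ N]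

namespace LightlikeSubmanifold

variable {g : SemiRiemannianMetric F N} (L : LightlikeSubmanifold E M g) {x : M}

theorem screen_le_tangent (x : M) : L.screen x ≤ L.tangent x :=
  le_sup_right.trans (L.screen_sup x).le

theorem screenTransversal_le_perp (x : M) :
    L.screenTransversal x ≤ perp (g.form (L.imm x)).toBilinForm (L.tangent x) :=
  le_sup_right.trans (L.screenTransversal_sup x).le

theorem ltr_le_perp (x : M) :
    L.ltr x ≤ perp (g.form (L.imm x)).toBilinForm (L.screen x ⊔ L.screenTransversal x) :=
  le_sup_right.trans (L.ltr_sup x).le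

theorem transversal_le_perp_screen (x : M) :
    L.ltr x ⊔ L.screenTransversal x ≤ perp (g.form (L.imm x)).toBilinForm (L.screen x) :=
  sup_le ((L.ltr_le_perp x).trans (LinearMap.BilinForm.orthogonal_le le_sup_left))
    ((L.screenTransversal_le_perp x).trans
      (LinearMap.BilinForm.orthogonal_le (L.screen_le_tangent x)))

theorem rad_le_perp_screen (x : M) :
    L.rad x ≤ perp (g.form (L.imm x)).toBilinForm (L.screen x) :=
  inf_le_right.trans (LinearMap.BilinForm.orthogonal_le (L.screen_le_tangent x))

theorem tangent_sup_ltr_le_perp (x : M) :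
    L.tangent x ⊔ L.ltr x ≤ perp (g.form (L.imm x)).toBilinForm (L.screenTransversal x) :=
  sup_le (fun t ht w hw ↦ (g.symm _ w t).trans (L.screenTransversal_le_perp x hw t ht))
    ((L.ltr_le_perp x).trans (LinearMap.BilinForm.orthogonal_le le_sup_right))

/-- If `Q` is orthogonal to `S`, then projecting along `Q` does not change products with `S`. -/
theorem form_projection {y : N} {P Q : Submodule ℝ (TangentSpace 𝓘(ℝ, F) y)} (h : IsCompl P Q)
    {S : Submodule ℝ (TangentSpace 𝓘(ℝ, F) y)} (hQ : Q ≤ perp (g.form y).toBilinForm S)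
    (a : TangentSpace 𝓘(ℝ, F) y) {z : TangentSpace 𝓘(ℝ, F) y} (hz : z ∈ S) :
    g.form y (Submodule.projection P Q h a) z = g.form y a z := by
  have h1 : g.form y z (Submodule.projection Q P h.symm a) = 0 :=
    hQ (Submodule.projection_apply_mem h.symm a) z hz
  have h2 := Submodule.projection_add_projection_eq_self h a
  conv_rhs => rw [← h2, map_add, add_apply, g.symm _ (Submodule.projection Q P h.symm a), h1,
    add_zero]

/-- All the components of `D_u V` other than the one in `S(TM)` are orthogonal to `S(TM)`. -/
theorem form_screenConnection (D : LinearConnection F N)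
    (V : ∀ x : M, TangentSpace 𝓘(ℝ, F) (L.imm x)) (u : TangentSpace 𝓘(ℝ, E) x)
    {z : TangentSpace 𝓘(ℝ, F) (L.imm x)} (hz : z ∈ L.screen x) :
    g.form (L.imm x) (L.screenConnection D V x u) z =
      g.form (L.imm x) (pullbackConnection D L.imm V x u) z :=
  (form_projection _ (sup_le (L.rad_le_perp_screen x) (L.transversal_le_perp_screen x)) _ hz).trans
    (form_projection _ (L.transversal_le_perp_screen x) _ hz)

/-- All the components of `D_u V` other than the one in `S(TM^⊥)` are orthogonal to `S(TM^⊥)`. -/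
theorem form_hs (D : LinearConnection F N)
    (V : ∀ x : M, TangentSpace 𝓘(ℝ, F) (L.imm x)) (u : TangentSpace 𝓘(ℝ, E) x)
    {w : TangentSpace 𝓘(ℝ, F) (L.imm x)} (hw : w ∈ L.screenTransversal x) :
    g.form (L.imm x) (L.hs D V x u) w =
      g.form (L.imm x) (pullbackConnection D L.imm V x u) w :=
  form_projection _ (L.tangent_sup_ltr_le_perp x) _ hw

theorem screenConnection_mem_screen (D : LinearConnection F N)
    (V : ∀ x : M, TangentSpace 𝓘(ℝ, F) (L.imm x)) (u : TangentSpace 𝓘(ℝ, E) x) :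
    L.screenConnection D V x u ∈ L.screen x :=
  Submodule.projection_apply_mem _ _

variable {B : ∀ x : M, Submodule ℝ (TangentSpace 𝓘(ℝ, F) (L.imm x))}

/-- Although `g` may be indefinite, `S(TM) = B ⊕ B^⊥` is nondegenerate, so `B` is recovered in `S(TM)`
as the orthogonal complement of `B^⊥`. -/
theorem mem_iff_forall_screenPerp (hB : B x ⊔ L.screenPerp B x = L.screen x)
    {s : TangentSpace 𝓘(ℝ, F) (L.imm x)} (hs : s ∈ L.screen x) :
    s ∈ B x ↔ ∀ z ∈ L.screenPerp B x, g.form (L.imm x) s z = 0 := by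
  refine ⟨fun h z hz ↦ hz.2 s h, fun h ↦ ?_⟩
  rw [← hB] at hs
  obtain ⟨b, hb, c, hc, rfl⟩ := Submodule.mem_sup.1 hs
  -- `c` is orthogonal to `B^⊥`, hence to `S(TM)`, hence to `TM`; so it is radical.
  have hcP : ∀ z ∈ L.screenPerp B x, g.form (L.imm x) z c = 0 := fun z hz ↦ by
    have h1 := h z hz
    rw [map_add, add_apply, (show g.form (L.imm x) b z = 0 from hz.2 b hb), zero_add] at h1
    rw [g.symm, h1]
  have hcT : c ∈ perp (g.form (L.imm x)).toBilinForm (L.tangent x) := by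
    intro t ht
    rw [tangent, ← L.screen_sup x, ← hB] at ht
    obtain ⟨e, he, s, hs, rfl⟩ := Submodule.mem_sup.1 ht
    obtain ⟨b', hb', c', hc', rfl⟩ := Submodule.mem_sup.1 hs
    change g.form (L.imm x) (e + (b' + c')) c = 0
    have h1 : g.form (L.imm x) b' c = 0 := hc.2 b' hb'
    have h2 : g.form (L.imm x) c e = 0 := he.2 c (L.screen_le_tangent x hc.1)
    rw [map_add, map_add, add_apply, add_apply, h1, hcP c' hc', g.symm, h2]
    simp
  have hc0 : c = 0 := Submodule.disjoint_def.1 (L.screen_disjoint x) c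
    ⟨L.screen_le_tangent x hc.1, hcT⟩ hc.1
  rwa [hc0, add_zero]

variable {nabla : LinearConnection F N}
  {J : ∀ y : N, TangentSpace 𝓘(ℝ, F) y →L[ℝ] TangentSpace 𝓘(ℝ, F) y} {p q : ℕ}
  {eta : ∀ y : N, TangentSpace 𝓘(ℝ, F) y} {V : ∀ x : M, TangentSpace 𝓘(ℝ, F) (L.imm x)}

theorem isSection_J (hJ : IsMetallic g J p q) (hB : L.IsScreenSemiInvariant J B)
    (hV : IsSection (E := E) L.imm B V) :
    IsSection (E := E) L.imm B (fun x ↦ J (L.imm x) (V x)) :=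
  ⟨((hJ.contMDiff.comp L.contMDiff_imm).contMDiffOn (s := Set.univ)).clm_bundle_apply hV.1,
    fun x ↦ hB.map_B x ▸ Submodule.mem_map_of_mem (f := (J (L.imm x)).toLinearMap) (hV.2 x)⟩

theorem pullbackConnection_apply_J (hJ : IsMetallic g J p q) (hJpar : IsParallel nabla J)
    (hV : IsSection (E := E) L.imm B V) (x : M) (u : TangentSpace 𝓘(ℝ, E) x) :
    pullbackConnection nabla L.imm (fun z ↦ J (L.imm z) (V z)) x u =
      J (L.imm x) (pullbackConnection nabla L.imm V x u) :=
  LightlikeGeometry.pullbackConnection_apply_of_isParallel hJ.contMDiff hJpar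
    (((contMDiffOn_univ.1 hV.1) x).mdifferentiableAt (by simp)) u

/-- `D^*_u (J² V) = p D^*_u (J V) + q D^*_u V`. As `J` is parallel, this follows from `J² = p J + q I`
with no appeal to the additivity of the pull-back connection. -/
theorem screenConnection_J_J (hJ : IsMetallic g J p q) (hJpar : IsParallel nabla J)
    (hB : L.IsScreenSemiInvariant J B)
    (hV : IsSection (E := E) L.imm B V) (u : TangentSpace 𝓘(ℝ, E) x) :
    L.screenConnection (quarterSymmetricConnection g nabla J eta)
        (fun z ↦ J (L.imm z) (J (L.imm z) (V z))) x u =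
      (p : ℝ) • L.screenConnection (quarterSymmetricConnection g nabla J eta)
        (fun z ↦ J (L.imm z) (V z)) x u +
      (q : ℝ) • L.screenConnection (quarterSymmetricConnection g nabla J eta) V x u := by
  simp only [screenConnection, inducedConnection, ← map_smul, ← map_add]
  congr 2
  simp only [pullbackConnection_quarterSymmetric]
  rw [L.pullbackConnection_apply_J hJ hJpar (L.isSection_J hJ hB hV),
    L.pullbackConnection_apply_J hJ hJpar hV]
  simp only [hJ.sq, map_add, map_smul, add_apply, smul_apply, smul_eq_mul]
  module

/-- The key identity: tested against `B^⊥`, the failure of `J h^s(u, V) = p π(V) J u + q π(V) u -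
π(J V) J u` is `D^*_u (J V)`. It comes from `g(J a, z) = g(a, J z)`, where
`J z ∈ S(TM^⊥)` for `z ∈ B^⊥`, and from `J ∇_u V = ∇_u (J V)`. -/
theorem form_J_hs (hJ : IsMetallic g J p q) (hJpar : IsParallel nabla J)
    (hB : L.IsScreenSemiInvariant J B)
    (hV : IsSection (E := E) L.imm B V) (u : TangentSpace 𝓘(ℝ, E) x)
    {z : TangentSpace 𝓘(ℝ, F) (L.imm x)} (hz : z ∈ L.screenPerp B x) :
    g.form (L.imm x) (J (L.imm x)
        (L.hs (quarterSymmetricConnection g nabla J eta) V x u)) z =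
      g.form (L.imm x) (L.screenConnection (quarterSymmetricConnection g nabla J eta)
        (fun z ↦ J (L.imm z) (V z)) x u) z +
      g.form (L.imm x)
        (((p : ℝ) * g.form (L.imm x) (V x) (eta (L.imm x))) •
            J (L.imm x) (mfderiv 𝓘(ℝ, E) 𝓘(ℝ, F) L.imm x u)
          + ((q : ℝ) * g.form (L.imm x) (V x) (eta (L.imm x))) •
            mfderiv 𝓘(ℝ, E) 𝓘(ℝ, F) L.imm x u
          - g.form (L.imm x) (J (L.imm x) (V x)) (eta (L.imm x)) •
            J (L.imm x) (mfderiv 𝓘(ℝ, E) 𝓘(ℝ, F) L.imm x u)) z := by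
  have hJz : J (L.imm x) z ∈ L.screenTransversal x :=
    hB.map_perp x (Submodule.mem_map_of_mem (f := (J (L.imm x)).toLinearMap) hz)
  rw [← hJ.compatible, L.form_hs _ _ _ hJz, hJ.compatible, L.form_screenConnection _ _ _ hz.1,
    ← add_apply, ← map_add]
  congr 2
  simp only [pullbackConnection_quarterSymmetric, L.pullbackConnection_apply_J hJ hJpar hV,
    map_add, map_smul, hJ.sq]
  module

/-- The equivalence holds with `U` ranging over the sections of any distribution `P`. -/
theorem totallyGeodesicInScreen_iff_screenIdentity (hJ : IsMetallic g J p q)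
    (hJpar : IsParallel nabla J) (hB : L.IsScreenSemiInvariant J B)
    (P : ∀ x : M, Submodule ℝ (TangentSpace 𝓘(ℝ, F) (L.imm x))) :
    L.TotallyGeodesicInScreen (quarterSymmetricConnection g nabla J eta) B P ↔
      L.ScreenIdentity (quarterSymmetricConnection g nabla J eta) J p q eta B P := by
  constructor
  · intro h U V hU hUP hV x z hz
    have h1 := h U _ hU hUP (L.isSection_J hJ hB hV) x
    rw [L.mem_iff_forall_screenPerp (hB.sup x) (L.screenConnection_mem_screen _ _ _)] at h1
    rw [L.form_J_hs hJ hJpar hB hV (U x) hz, h1 z hz, zero_add]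
    rfl
  · intro h U V hU hUP hV x
    have key : ∀ {V : ∀ x : M, TangentSpace 𝓘(ℝ, F) (L.imm x)}, IsSection (E := E) L.imm B V →
        L.screenConnection (quarterSymmetricConnection g nabla J eta)
          (fun z ↦ J (L.imm z) (V z)) x (U x) ∈ B x := by
      intro V hV
      rw [L.mem_iff_forall_screenPerp (hB.sup x) (L.screenConnection_mem_screen _ _ _)]
      intro z hz
      have h1 := h U V hU hUP hV x z hz
      rw [L.form_J_hs hJ hJpar hB hV (U x) hz] at h1
      exact add_eq_right.1 h1
    -- `J² = p J + q I` with `q ≠ 0` recovers `V` from the sections `J V` and `J (J V)`.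
    have hq : (q : ℝ) ≠ 0 := by exact_mod_cast hJ.q_pos.ne'
    have h2 := key (L.isSection_J hJ hB hV)
    rw [L.screenConnection_J_J hJ hJpar hB hV,
      Submodule.add_mem_iff_right _ (Submodule.smul_mem _ _ (key hV))] at h2
    exact (Submodule.smul_mem_iff _ hq).1 h2

end LightlikeSubmanifold
end Submanifold
end LightlikeGeometry

theorem mainTheorem10
    {E : Type*} [NormedAddCommGroup E] [NormedSpace ℝ E] [FiniteDimensional ℝ E]
    {M : Type*} [TopologicalSpace M] [T2Space M] [SecondCountableTopology M]
    [ChartedSpace E M] [IsManifold 𝓘(ℝ, E) ∞ M]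
    {F : Type*} [NormedAddCommGroup F] [NormedSpace ℝ F] [FiniteDimensional ℝ F]
    {N : Type*} [TopologicalSpace N] [T2Space N] [SecondCountableTopology N]
    [ChartedSpace F N] [IsManifold 𝓘(ℝ, F) ∞ N]
    (g : SemiRiemannianMetric F N) (nabla : LinearConnection F N) (hnabla : IsLeviCivita g nabla)
    (J : ∀ y : N, TangentSpace 𝓘(ℝ, F) y →L[ℝ] TangentSpace 𝓘(ℝ, F) y) (p q : ℕ)
    (hJ : IsMetallic g J p q) (hJpar : IsParallel nabla J)
    (eta : ∀ y : N, TangentSpace 𝓘(ℝ, F) y) (heta : SmoothField eta)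
    (L : LightlikeSubmanifold E M g)
    (B : ∀ x : M, Submodule ℝ (TangentSpace 𝓘(ℝ, F) (L.imm x)))
    (hB : L.IsScreenSemiInvariant J B) :
    (L.TotallyGeodesicInScreen (quarterSymmetricConnection g nabla J eta) B L.tangent ↔
      L.ScreenIdentity (quarterSymmetricConnection g nabla J eta) J p q eta B L.tangent) ∧
    (L.TotallyGeodesicInScreen (quarterSymmetricConnection g nabla J eta) B B ↔
      L.ScreenIdentity (quarterSymmetricConnection g nabla J eta) J p q eta B B) :=
  ⟨L.totallyGeodesicInScreen_iff_screenIdentity hJ hJpar hB _,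
    L.totallyGeodesicInScreen_iff_screenIdentity hJ hJpar hB _⟩
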